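/- Let $F$ be a field of characteristic $2$, let $[F:F^2]\in\mathbb{N}\cup\{\infty\}$ be its degree over the subfield $F^2$ of squares, and let $Q$ be an $F$-quaternion division algebra (a central division $F$-algebra of dimension $4$ over $F$). Let $\theta$ be any $F$-involution on $Q$, i.e. an $F$-linear map with $\theta(xy)=\theta(y)\theta(x)$ and $\theta^2=\mathrm{id}$, and put $\mathrm{Alt}(Q,\theta)=\{a-\theta(a)\mid a\in Q\}$. A hermitian form over $(Q,\theta)$ is a bi-additive map $h:V\times V\to Q$ on a finite-dimensional right $Q$-vector space $V$ with $h(xd_1,yd_2)=\theta(d_1)h(x,y)d_2$ and $h(y,x)=\theta(h(x,y))$; it is anisotropic if $h(x,x)\neq 0$ for all $x\neq 0$. A (generalised) quadratic form over $(Q,\theta)$ is a map $q:V\to Q/\mathrm{Alt}(Q,\theta)$ on such a $V$ with $q(xd)=\theta(d)q(x)d$ and such that $q(x+y)-q(x)-q(y)=h(x,y)+\mathrm{Alt}(Q,\theta)$ for some hermitian form $h$ over $(Q,\theta)$; it is anisotropic if $q(x)\neq 0$ for all $x\neq 0$. Let $u^+(Q)$ and $u(Q)$ in $\mathbb{N}\cup\{\infty\}$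 be the suprema of $\dim_Q V$ over all anisotropic hermitian forms, respectively all anisotropic quadratic forms, over $(Q,\theta)$ (possibly singular). These suprema do not depend on the choice of $\theta$. Then $$u^+(Q)\leqslant [F:F^2]\qquad\text{and}\qquad u(Q)\leqslant \tfrac{3}{2}\,[F:F^2].$$ -/

import Mathlib

open scoped ENNReal

noncomputable section

namespace GenForm

universe u v w

/-- An `F`-involution on an `F`-algebra `D`: an `F`-linear map `θ : D → D` with
`θ (x * y) = θ y * θ x` and `θ (θ x) = x`. -/
structure FInvolution (F : Type u) (D : Type v) [Field F] [Ring D] [Algebra F D]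
    extends D →ₗ[F] D where
  map_mul_rev' : ∀ x y : D, toFun (x * y) = toFun y * toFun x
  involutive' : ∀ x : D, toFun (toFun x) = x

section

variable {F : Type u} {D : Type v} [Field F] [Ring D] [Algebra F D]

instance : CoeFun (FInvolution F D) (fun _ => D → D) := ⟨fun θ => θ.toLinearMap⟩

/-- `Alt(D, θ) = {a - θ a | a ∈ D}`, an `F`-subspace of `D`. -/
def Alt (θ : FInvolution F D) : Submodule F D :=
  LinearMap.range (LinearMap.id - θ.toLinearMap)

/-- The `F`-linear map `a ↦ θ d * a * d` on `D`. -/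
def conjMap (θ : FInvolution F D) (d : D) : D →ₗ[F] D :=
  LinearMap.mulLeft F (θ d) ∘ₗ LinearMap.mulRight F d

theorem alt_le_comap_conjMap (θ : FInvolution F D) (d : D) :
    Alt θ ≤ (Alt θ).comap (conjMap θ d) := by
  rintro _ ⟨a, rfl⟩
  refine ⟨θ d * (a * d), ?_⟩
  have h1 : θ (θ d * (a * d)) = θ d * (θ a * d) := by
    have e1 := θ.map_mul_rev' (θ d) (a * d)
    have e2 := θ.map_mul_rev' a d
    have e3 := θ.involutive' d
    change θ (θ d * (a * d)) = θ (a * d) * θ (θ d) at e1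
    change θ (a * d) = θ d * θ a at e2
    change θ (θ d) = d at e3
    rw [e1, e2, e3, mul_assoc]
  simp only [conjMap, LinearMap.sub_apply, LinearMap.id_apply, LinearMap.comp_apply,
    LinearMap.mulLeft_apply, LinearMap.mulRight_apply, sub_mul, mul_sub]
  rw [h1]

/-- The map `D / Alt(D, θ) → D / Alt(D, θ)` induced by `a ↦ θ d * a * d`. -/
def conjQuot (θ : FInvolution F D) (d : D) : (D ⧸ Alt θ) →ₗ[F] (D ⧸ Alt θ) :=
  (Alt θ).mapQ (Alt θ) (conjMap θ d) (alt_le_comap_conjMap θ d)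

/-- A hermitian form over `(D, θ)` on the right `D`-module `V`: a bi-additive map `h : V × V → D`
with `h (x d₁, y d₂) = θ(d₁) h(x, y) d₂` and `h(y, x) = θ(h(x, y))`.
Right `D`-modules are modules over `Dᵐᵒᵖ`. -/
structure HermForm (θ : FInvolution F D) (V : Type w) [AddCommGroup V] [Module Dᵐᵒᵖ V] where
  form : V →+ V →+ D
  map_smul_smul : ∀ (x y : V) (d₁ d₂ : D),
    form (MulOpposite.op d₁ • x) (MulOpposite.op d₂ • y) = θ d₁ * form x y * d₂
  symm : ∀ x y : V, form y x = θ (form x y)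

/-- A hermitian form is anisotropic if `h(x, x) ≠ 0` for all `x ≠ 0`. -/
def HermForm.IsAnisotropic {θ : FInvolution F D} {V : Type w} [AddCommGroup V] [Module Dᵐᵒᵖ V]
    (φ : HermForm θ V) : Prop :=
  ∀ x : V, x ≠ 0 → φ.form x x ≠ 0

/-- A (generalised) quadratic form over `(D, θ)` on the right `D`-module `V`: a map
`q : V → D / Alt(D, θ)` with `q(x d) = θ(d) q(x) d`, and such that
`q(x + y) - q(x) - q(y) = h(x, y) + Alt(D, θ)` for some hermitian form `h` over `(D, θ)`. -/
structure QuadForm (θ : FInvolution F D) (V : Type w) [AddCommGroup V] [Module Dᵐᵒᵖ V] where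
  form : V → D ⧸ Alt θ
  map_smul : ∀ (x : V) (d : D), form (MulOpposite.op d • x) = conjQuot θ d (form x)
  exists_polar : ∃ φ : HermForm θ V, ∀ x y : V,
    form (x + y) - form x - form y = (Alt θ).mkQ (φ.form x y)

/-- A quadratic form is anisotropic if `q(x) ≠ 0` in `D / Alt(D, θ)` for all `x ≠ 0`. -/
def QuadForm.IsAnisotropic {θ : FInvolution F D} {V : Type w} [AddCommGroup V] [Module Dᵐᵒᵖ V]
    (ρ : QuadForm θ V) : Prop :=
  ∀ x : V, x ≠ 0 → ρ.form x ≠ 0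

end

section

variable {F : Type u} {D : Type v} [Field F] [DivisionRing D] [Algebra F D]

/-- The invariant `u⁺`, computed with the involution `θ`: the supremum in `ℕ ∪ {∞}` of the
dimensions of the anisotropic hermitian forms over `(D, θ)` on finite-dimensional right
`D`-vector spaces. -/
def uPlus (θ : FInvolution F D) : ℕ∞ :=
  sSup {n : ℕ∞ | ∃ (V : Type v) (_ : AddCommGroup V) (_ : Module Dᵐᵒᵖ V)
    (_ : Module.Finite Dᵐᵒᵖ V) (φ : HermForm θ V),
    φ.IsAnisotropic ∧ n = (Module.finrank Dᵐᵒᵖ V : ℕ∞)}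

/-- The invariant `u`, computed with the involution `θ`: the supremum in `ℕ ∪ {∞}` of the
dimensions of the anisotropic quadratic forms over `(D, θ)` on finite-dimensional right
`D`-vector spaces. -/
def uInv (θ : FInvolution F D) : ℕ∞ :=
  sSup {n : ℕ∞ | ∃ (V : Type v) (_ : AddCommGroup V) (_ : Module Dᵐᵒᵖ V)
    (_ : Module.Finite Dᵐᵒᵖ V) (ρ : QuadForm θ V),
    ρ.IsAnisotropic ∧ n = (Module.finrank Dᵐᵒᵖ V : ℕ∞)}

end

/-- `[F : F²] ∈ ℕ ∪ {∞}`, the degree of `F` over its subfield of squares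
(the image of the Frobenius endomorphism), for `F` of characteristic two. -/
def degSq (F : Type u) [Field F] [CharP F 2] : ℕ∞ :=
  Cardinal.toENat (Module.rank (frobenius F 2).fieldRange F)

end GenForm

end

/-! Write d for [F:F²], assumed finite, since otherwise both bounds are trivial. The symmetric
elements Sym = ker(id - θ) contain Alt; here dim Alt = 1 and dim Sym/Alt = 2 over F (`finrank_alt`,
`finrank_ker_altQuot`). An additive map f with f(cx) = c²f(x) and no nonzero zeros multiplies
dimensions by at most d, since it carries an F-basis to an F²-independent family. An anisotropic
F-quadratic form q then has dimension at most 2d: its polar form is alternating, so some totally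
isotropic subspace has at least half the dimension, and q is such a map on it.

Hermitian case, n = dim_Q V: x ↦ h(x,x) mod Alt is additive into Sym/Alt, so it vanishes on an
F-subspace of dimension at least 4n - 2d. There h(x,x) takes values in the line Alt and is an
anisotropic F-quadratic form, so 4n - 2d ≤ 2d.

Quadratic case: the polar form h has h(x,x) ∈ Alt. Split off a maximal totally isotropic W and a
complement C of W in its orthogonal, so n ≤ 2 dim W + dim C. On C the form x ↦ h(x,x) is F-quadratic
and anisotropic, whence 4 dim C ≤ 2d; on W the form q is additive with values in Sym/Alt, whence 4
dim W ≤ 2d. -/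

namespace GenForm

/-! ### Dimension bounds for Frobenius-semilinear maps, and isotropic subspaces -/

section SemilinearDimension

variable {F : Type*} [Field F] [CharP F 2]

theorem finrank_le_of_semilinear_injective
    [Module.Finite (frobenius F 2).fieldRange F]
    {V M : Type*} [AddCommGroup V] [Module F V] [Module.Finite F V]
    [AddCommGroup M] [Module F M] [Module.Finite F M]
    (f : V → M) (hadd : ∀ x y, f (x + y) = f x + f y)
    (hsmul : ∀ (c : F) x, f (c • x) = c ^ 2 • f x) (hf : ∀ x, f x = 0 → x = 0) :
    Module.finrank F V ≤
      Module.finrank (frobenius F 2).fieldRange F * Module.finrank F M := by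
  set S := (frobenius F 2).fieldRange
  let g : V →+ M := AddMonoidHom.mk' f hadd
  let b := Module.finBasis F V
  have : Module.Finite S M := Module.Finite.trans F M
  have hli : LinearIndependent S (fun i => f (b i)) := by
    rw [Fintype.linearIndependent_iff]
    intro c hc i
    choose r hr using fun i => (c i).2
    have h1 : g (∑ i, r i • b i) = 0 := by
      rw [map_sum, ← hc]
      refine Finset.sum_congr rfl fun i _ => ?_
      change f (r i • b i) = _
      rw [hsmul]
      change _ = (c i : F) • f (b i)
      rw [← hr i]
      rfl
    have h2 := Fintype.linearIndependent_iff.1 b.linearIndependent r (hf _ h1) i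
    apply Subtype.ext
    rw [← hr i, h2]
    simp
  have := hli.fintype_card_le_finrank
  rwa [Fintype.card_fin, ← Module.finrank_mul_finrank S F M] at this

/-- The zero set is itself an F-subspace, and the injective bound applies on a complement of it. -/
theorem exists_finrank_le_add_of_semilinear
    [Module.Finite (frobenius F 2).fieldRange F]
    {V M : Type*} [AddCommGroup V] [Module F V] [Module.Finite F V]
    [AddCommGroup M] [Module F M] [Module.Finite F M]
    (f : V → M) (hadd : ∀ x y, f (x + y) = f x + f y)
    (hsmul : ∀ (c : F) x, f (c • x) = c ^ 2 • f x) :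
    ∃ K : Submodule F V, (∀ x ∈ K, f x = 0) ∧ Module.finrank F V ≤ Module.finrank F K +
      Module.finrank (frobenius F 2).fieldRange F * Module.finrank F M := by
  let K : Submodule F V :=
    { carrier := {x | f x = 0}
      zero_mem' := by simpa using hsmul 0 0
      add_mem' := fun {x y} hx hy => by
        rw [Set.mem_ofPred_eq] at *
        rw [hadd, hx, hy, add_zero]
      smul_mem' := fun c x hx => by
        rw [Set.mem_ofPred_eq] at *
        rw [hsmul, hx, smul_zero] }
  obtain ⟨C, hC⟩ := K.exists_isCompl
  refine ⟨K, fun x hx => hx, ?_⟩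
  rw [← Submodule.finrank_add_eq_of_isCompl hC]
  gcongr
  refine finrank_le_of_semilinear_injective (fun x : C => f x) (fun x y => hadd x y)
    (fun c x => hsmul c x) fun x hx => ?_
  exact Subtype.ext (Submodule.disjoint_def.1 hC.disjoint x hx x.2)

end SemilinearDimension

/-- For a reflexive form `ψ`, there are a totally isotropic subspace `W` and a subspace `C` without
isotropic vectors (a complement of `W` in its orthogonal) such that `dim V ≤ 2 dim W + dim C`. -/
theorem exists_isotropic_anisotropic {D V P : Type*} [DivisionRing D] [AddCommGroup V] [Module D V]
    [Module.Finite D V] [AddCommGroup P] [Module D P] [Module.Finite D P]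
    (hP : Module.finrank D P = 1)
    (ψ : V → V →ₗ[D] P) (hψ : ∀ x y, ψ x y = 0 → ψ y x = 0) :
    ∃ W C : Submodule D V, (∀ x ∈ W, ∀ y ∈ W, ψ x y = 0) ∧ (∀ x ∈ C, ψ x x = 0 → x = 0) ∧
      Module.finrank D V ≤ 2 * Module.finrank D W + Module.finrank D C := by
  -- Minimality for `>` makes W a maximal totally isotropic subspace; `ker Φ` below is its
  -- orthogonal.
  obtain ⟨W, hW, hmax⟩ := WellFounded.has_min (wellFounded_gt (α := Submodule D V))
    {W | ∀ x ∈ W, ∀ y ∈ W, ψ x y = 0} ⟨⊥, by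
      intro x _ y hy
      rw [(Submodule.mem_bot D).1 hy, map_zero]⟩
  let b := Module.finBasis D W
  let Φ : V →ₗ[D] (Fin (Module.finrank D W) → P) := LinearMap.pi fun i => ψ (b i)
  have hker : ∀ y, y ∈ LinearMap.ker Φ ↔ ∀ x ∈ W, ψ x y = 0 := by
    intro y
    constructor
    · intro hy x hx
      have h1 : ∀ i, ψ y (b i) = 0 := fun i => hψ _ _ (congrFun (LinearMap.mem_ker.1 hy) i)
      have h2 : (ψ y).comp W.subtype = 0 := b.ext fun i => h1 i
      exact hψ _ _ (LinearMap.congr_fun h2 ⟨x, hx⟩)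
    · intro h
      rw [LinearMap.mem_ker]
      exact funext fun i => h _ (b i).2
  have hrank : Module.finrank D V ≤ Module.finrank D W + Module.finrank D (LinearMap.ker Φ) := by
    rw [← LinearMap.finrank_range_add_finrank_ker Φ]
    gcongr
    refine (Submodule.finrank_le _).trans ?_
    rw [Module.finrank_pi_fintype]
    simp [hP]
  have hle : W ≤ LinearMap.ker Φ := fun y hy => (hker y).2 fun x hx => hW x hx y hy
  obtain ⟨C₀, hC₀⟩ := (W.comap (LinearMap.ker Φ).subtype).exists_isCompl
  refine ⟨W, C₀.map (LinearMap.ker Φ).subtype, hW, ?_, ?_⟩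
  · rintro _ ⟨c, hc, rfl⟩ hcc
    have hmem : (c : V) ∈ W := by
      -- An isotropic vector orthogonal to W can be adjoined to W, so by maximality it already lies
      -- in W.
      have hlt := hmax (W ⊔ Submodule.span D {(c : V)}) (by
        intro x hx y hy
        obtain ⟨x₁, hx₁, x₂, hx₂, rfl⟩ := Submodule.mem_sup.1 hx
        obtain ⟨y₁, hy₁, y₂, hy₂, rfl⟩ := Submodule.mem_sup.1 hy
        obtain ⟨r, rfl⟩ := Submodule.mem_span_singleton.1 hx₂
        obtain ⟨s, rfl⟩ := Submodule.mem_span_singleton.1 hy₂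
        have hc1 : ∀ w ∈ W, ψ w c = 0 := (hker c).1 c.2
        have h1 : ∀ w ∈ W, ψ (x₁ + r • (c : V)) w = 0 := fun w hw => by
          refine hψ _ _ ?_
          rw [map_add, map_smul, hW w hw x₁ hx₁, hc1 w hw, smul_zero, add_zero]
        have h2 : ψ (x₁ + r • (c : V)) c = 0 := by
          refine hψ _ _ ?_
          rw [map_add, map_smul, hψ _ _ (hc1 x₁ hx₁)]
          change 0 + r • ψ c c = 0
          rw [show ψ c c = 0 from hcc, smul_zero, add_zero]
        rw [map_add, map_smul, h1 _ hy₁, h2, smul_zero, add_zero])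
      have hWe : W = W ⊔ Submodule.span D {(c : V)} :=
        le_antisymm le_sup_left (not_lt_iff_le_imp_ge.1 hlt le_sup_left)
      exact hWe.ge (Submodule.mem_sup_right (Submodule.mem_span_singleton_self _))
    have := Submodule.disjoint_def.1 hC₀.disjoint c hmem hc
    rw [this, map_zero]
  · rw [← ((LinearMap.ker Φ).equivSubtypeMap C₀).finrank_eq]
    rw [← Submodule.finrank_add_eq_of_isCompl hC₀,
      (Submodule.comapSubtypeEquivOfLe hle).finrank_eq] at hrank
    omega

/-- An anisotropic quadratic form over a field of characteristic two, singular or not, has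
dimension at most `2 [F : F²]`. -/
theorem finrank_le_of_anisotropic {F : Type*} [Field F] [CharP F 2]
    [Module.Finite (frobenius F 2).fieldRange F]
    {V P : Type*} [AddCommGroup V] [Module F V] [Module.Finite F V]
    [AddCommGroup P] [Module F P] [Module.Finite F P] (hP : Module.finrank F P = 1)
    (q : V → P) (B : V → V →ₗ[F] P) (hB : ∀ x y, q (x + y) = q x + q y + B x y)
    (hsmul : ∀ (c : F) x, q (c • x) = c ^ 2 • q x) (hq : ∀ x, q x = 0 → x = 0) :
    Module.finrank F V ≤ 2 * Module.finrank (frobenius F 2).fieldRange F := by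
  have h2 : (2 : F) = 0 := CharTwo.two_eq_zero
  have hBB : ∀ x, B x x = 0 := fun x => by
    have h := hB x x
    have e1 : q (x + x) = 0 := by
      rw [← two_smul F x, hsmul, h2, zero_pow two_ne_zero, zero_smul]
    rwa [e1, ← two_smul F (q x), h2, zero_smul, zero_add, eq_comm] at h
  have hsymm : ∀ x y, B x y = B y x := fun x y => by
    have h := hB x y
    rw [add_comm x y, hB y x, add_comm (q x)] at h
    exact (add_left_cancel h).symm
  obtain ⟨W, C, hW, hC, hle⟩ := exists_isotropic_anisotropic hP B
    fun x y h => (hsymm y x).trans h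
  have hC0 : C = ⊥ := (Submodule.eq_bot_iff _).2 fun x hx => hC x hx (hBB x)
  have hWd := finrank_le_of_semilinear_injective (fun x : W => q x)
    (fun x y => by
      change q (x + y) = _
      rw [hB, hW x x.2 y y.2, add_zero]) (fun c x => hsmul c x)
    fun x hx => Subtype.ext (hq x hx)
  rw [hP, mul_one] at hWd
  rw [hC0, finrank_bot] at hle
  omega

/-! ### Alternating and symmetric elements of an involution -/

section Involution

variable {F : Type*} [Field F] {Q : Type*}

theorem FInvolution.apply_mul [Ring Q] [Algebra F Q] (θ : FInvolution F Q) (x y : Q) :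
    θ (x * y) = θ y * θ x := θ.map_mul_rev' x y

theorem FInvolution.apply_apply [Ring Q] [Algebra F Q] (θ : FInvolution F Q) (x : Q) :
    θ (θ x) = x := θ.involutive' x

theorem FInvolution.apply_one [Ring Q] [Algebra F Q] (θ : FInvolution F Q) : θ 1 = 1 := by
  have h := θ.apply_mul (θ 1) 1
  rwa [mul_one, θ.apply_apply, mul_one, eq_comm] at h

theorem finrank_ker_add_finrank_alt [Ring Q] [Algebra F Q] [Module.Finite F Q]
    (θ : FInvolution F Q) :
    Module.finrank F (Alt θ) +
      Module.finrank F (LinearMap.ker (LinearMap.id - θ.toLinearMap)) = Module.finrank F Q :=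
  LinearMap.finrank_range_add_finrank_ker _

theorem mem_ker_iff [Ring Q] [Algebra F Q] (θ : FInvolution F Q) (x : Q) :
    x ∈ LinearMap.ker (LinearMap.id - θ.toLinearMap) ↔ θ x = x := by
  rw [LinearMap.mem_ker, LinearMap.sub_apply, LinearMap.id_apply, sub_eq_zero, eq_comm]

variable [CharP F 2]

theorem sub_eq_add_of_algebra [Ring Q] [Algebra F Q] (x y : Q) : x - y = x + y := by
  have h : y + y = 0 := by
    rw [← two_smul F y, CharTwo.two_eq_zero, zero_smul]
  rw [sub_eq_iff_eq_add, add_assoc, h, add_zero]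

theorem mem_alt_iff [Ring Q] [Algebra F Q] (θ : FInvolution F Q) (x : Q) :
    x ∈ Alt θ ↔ ∃ a, a + θ a = x := by
  simp [Alt, LinearMap.mem_range, sub_eq_add_of_algebra (F := F)]

theorem alt_le_ker [Ring Q] [Algebra F Q] (θ : FInvolution F Q) :
    Alt θ ≤ LinearMap.ker (LinearMap.id - θ.toLinearMap) := by
  intro x hx
  obtain ⟨a, rfl⟩ := (mem_alt_iff θ x).1 hx
  rw [LinearMap.mem_ker, LinearMap.sub_apply, LinearMap.id_apply, map_add, θ.apply_apply,
    add_comm, sub_self]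

end Involution

/-! ### Quaternion algebras and forms over them -/

section Quaternion

variable {F : Type*} [Field F] {Q : Type*} [DivisionRing Q] [Algebra F Q]

theorem exists_mul_ne_mul [Algebra.IsCentral F Q] (hQ : Module.finrank F Q = 4) :
    ∃ x y : Q, x * y ≠ y * x := by
  by_contra! h
  have : Subalgebra.center F Q = ⊤ := by
    ext x
    simp only [Subalgebra.mem_center_iff, Algebra.mem_top, iff_true]
    exact fun y => h y x
  rw [Algebra.IsCentral.center_eq_bot] at this
  have h2 := Subalgebra.finrank_bot (F := F) (E := Q)
  rw [this, subalgebra_top_finrank_eq_submodule_top_finrank, finrank_top] at h2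
  omega

/-- The elements of a two-dimensional subspace containing `1` commute. -/
theorem mul_comm_of_finrank_eq_two {S : Submodule F Q} (hS : Module.finrank F S = 2)
    (h1 : (1 : Q) ∈ S) {x y : Q} (hx : x ∈ S) (hy : y ∈ S) : x * y = y * x := by
  have : Module.Finite F S := Module.finite_of_finrank_pos (by omega)
  by_cases hli : LinearIndependent F ![1, x]
  · have hle : Submodule.span F (Set.range ![1, x]) ≤ S := by
      rw [Submodule.span_le]
      rintro _ ⟨i, rfl⟩
      fin_cases i
      · exact h1
      · exact hx
    have heq := Submodule.eq_of_le_of_finrank_eq hle (by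
      rw [finrank_span_eq_card hli, hS, Fintype.card_fin])
    rw [← heq, Matrix.range_cons, Matrix.range_cons, Matrix.range_empty, Set.union_empty,
      Set.singleton_union, Submodule.mem_span_pair] at hy
    obtain ⟨a, b, rfl⟩ := hy
    simp [mul_add, add_mul]
  · rw [LinearIndependent.pair_iff' one_ne_zero] at hli
    push Not at hli
    obtain ⟨a, rfl⟩ := hli
    simp

theorem conjQuot_algebraMap (θ : FInvolution F Q) (c : F) (z : Q ⧸ Alt θ) :
    conjQuot θ (algebraMap F Q c) z = c ^ 2 • z := by
  obtain ⟨a, rfl⟩ := (Alt θ).mkQ_surjective z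
  change (Alt θ).mkQ (θ (algebraMap F Q c) * (a * algebraMap F Q c)) = _
  rw [← map_smul, Algebra.algebraMap_eq_smul_one, map_smul, θ.apply_one]
  simp [smul_smul, sq]

section Forms

variable {θ : FInvolution F Q} {V : Type*} [AddCommGroup V] [Module Qᵐᵒᵖ V]

theorem HermForm.form_smul_right (φ : HermForm θ V) (x y : V) (d : Q) :
    φ.form x (MulOpposite.op d • y) = φ.form x y * d := by
  have h := φ.map_smul_smul x y 1 d
  rwa [MulOpposite.op_one, one_smul, θ.apply_one, one_mul] at h

/-- The form `h(x, ·)` as a linear map of right `Q`-vector spaces. -/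
def HermForm.toLinearMapRight (φ : HermForm θ V) (x : V) : V →ₗ[Qᵐᵒᵖ] Q where
  toFun := φ.form x
  map_add' := map_add _
  map_smul' d y := φ.form_smul_right x y d.unop

theorem HermForm.form_eq_zero_symm (φ : HermForm θ V) {x y : V} (h : φ.form x y = 0) :
    φ.form y x = 0 := by
  rw [φ.symm, h, map_zero]

theorem HermForm.apply_form_self (φ : HermForm θ V) (x : V) :
    θ (φ.form x x) = φ.form x x := (φ.symm x x).symm

theorem HermForm.form_add_self (φ : HermForm θ V) (x y : V) :
    φ.form (x + y) (x + y) =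
      φ.form x x + φ.form y y + (φ.form x y + θ (φ.form x y)) := by
  rw [← φ.symm x y]
  simp only [map_add, AddMonoidHom.add_apply]
  abel

variable [Module F V] [IsScalarTower F Qᵐᵒᵖ V]

theorem smul_eq_op_smul (c : F) (x : V) : c • x = MulOpposite.op (algebraMap F Q c) • x := by
  rw [← MulOpposite.algebraMap_apply, algebraMap_smul]

theorem HermForm.form_smul_right_field (φ : HermForm θ V) (x y : V) (c : F) :
    φ.form x (c • y) = c • φ.form x y := by
  rw [smul_eq_op_smul (Q := Q), φ.form_smul_right, ← Algebra.commutes, Algebra.smul_def]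

theorem HermForm.form_smul_self (φ : HermForm θ V) (x : V) (c : F) :
    φ.form (c • x) (c • x) = c ^ 2 • φ.form x x := by
  rw [φ.form_smul_right_field, φ.symm, φ.form_smul_right_field, map_smul, φ.apply_form_self,
    smul_smul, sq]

theorem finrank_eq_four_mul (hQ : Module.finrank F Q = 4) (W : Submodule Qᵐᵒᵖ V) :
    Module.finrank F (W.restrictScalars F) = 4 * Module.finrank Qᵐᵒᵖ W := by
  have h := Module.finrank_mul_finrank F Qᵐᵒᵖ W
  rw [← (MulOpposite.opLinearEquiv F (M := Q)).finrank_eq, hQ] at h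
  exact h.symm

end Forms

variable [CharP F 2]

/-- Since Alt ⊆ Sym and their dimensions add up to 4, dim Alt ≤ 2. Dimension 0 means θ = id, and
dimension 2 means Alt = Sym; either would make Q commutative. -/
theorem finrank_alt [Algebra.IsCentral F Q] (hQ : Module.finrank F Q = 4)
    (θ : FInvolution F Q) : Module.finrank F (Alt θ) = 1 := by
  have hfin : Module.Finite F Q := Module.finite_of_finrank_pos (by omega)
  have : CharP Q 2 := charP_of_injective_algebraMap (algebraMap F Q).injective 2
  obtain ⟨u, v, huv⟩ := exists_mul_ne_mul hQ
  have hsum := finrank_ker_add_finrank_alt θ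
  have hle := Submodule.finrank_mono (alt_le_ker θ)
  have h0 : Module.finrank F (Alt θ) ≠ 0 := by
    intro h
    have hid : ∀ x, θ x = x := fun x => by
      have : x + θ x ∈ Alt θ := (mem_alt_iff θ _).2 ⟨x, rfl⟩
      rw [Submodule.finrank_eq_zero.1 h, Submodule.mem_bot] at this
      exact (CharTwo.add_eq_zero.1 this).symm
    apply huv
    rw [← hid (u * v), θ.apply_mul, hid, hid]
  have h2 : Module.finrank F (Alt θ) ≠ 2 := by
    intro h
    have hS : ∀ x, x ∈ Alt θ ↔ θ x = x := fun x => by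
      rw [Submodule.eq_of_le_of_finrank_eq (alt_le_ker θ) (by omega), mem_ker_iff]
    have h1 : (1 : Q) ∈ Alt θ := (hS 1).2 θ.apply_one
    have hcomm : ∀ {x y}, x ∈ Alt θ → y ∈ Alt θ → x * y = y * x :=
      fun hx hy => mul_comm_of_finrank_eq_two h h1 hx hy
    -- As 1 ∈ Sym = Alt, some c has θ(c) = c + 1. Once c is shown to commute with Sym, the
    -- commutativity of Sym and Q = c·Sym + Sym make Q commutative.
    obtain ⟨c, hc⟩ := (mem_alt_iff θ 1).1 h1
    have hc' : θ c = c + 1 := by rw [← hc, ← add_assoc, CharTwo.add_self_eq_zero, zero_add]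
    have hcS : ∀ s ∈ Alt θ, c * s = s * c := by
      intro s hs
      have hm : c * s + s * c ∈ Alt θ := by
        rw [hS, map_add, θ.apply_mul, θ.apply_mul, hc', (hS s).1 hs]
        calc s * (c + 1) + (c + 1) * s = c * s + s * c + (s + s) := by noncomm_ring
          _ = _ := by rw [CharTwo.add_self_eq_zero, add_zero]
      have he : c * c + c ∈ Alt θ := by
        rw [hS, map_add, θ.apply_mul, hc']
        calc (c + 1) * (c + 1) + (c + 1) = c * c + c + ((c + c) + (1 + 1)) := by noncomm_ring
          _ = _ := by simp only [CharTwo.add_self_eq_zero, add_zero]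
      have hes := hcomm he hs
      set m := c * s + s * c with hmdef
      -- This encodes that c² + c ∈ Sym commutes with s. Since cm ∈ Sym also commutes with m,
      -- cancelling a nonzero m would give cm = mc, hence m = 0.
      have hcm : c * m = m * c + m := by
        rw [← CharTwo.add_eq_zero]
        calc c * m + (m * c + m) = (c * c + c) * s + s * (c * c + c) + (c * s * c + c * s * c) := by
              rw [hmdef]; noncomm_ring
          _ = 0 := by rw [hes, CharTwo.add_self_eq_zero, CharTwo.add_self_eq_zero, add_zero]
      have hcmS : c * m ∈ Alt θ := by
        rw [hS, θ.apply_mul, hc', (hS m).1 hm, hcm, mul_add, mul_one]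
      have hm0 : m = 0 := by
        by_contra hne
        have h3 := hcomm hcmS hm
        rw [← mul_assoc] at h3
        have h4 := mul_right_cancel₀ hne h3
        rw [h4] at hcm
        exact hne (left_eq_add.1 hcm)
      exact CharTwo.add_eq_zero.1 hm0
    have hdec : ∀ x, ∃ s ∈ Alt θ, ∃ t ∈ Alt θ, x = c * s + t := by
      intro x
      have hs : x + θ x ∈ Alt θ := (mem_alt_iff θ _).2 ⟨x, rfl⟩
      refine ⟨_, hs, x + c * (x + θ x), ?_, ?_⟩
      · rw [hS, map_add, θ.apply_mul, hc', (hS _).1 hs, mul_add, ← hcS _ hs, mul_one]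
        calc θ x + (c * (x + θ x) + (x + θ x)) = x + c * (x + θ x) + (θ x + θ x) := by abel
          _ = _ := by rw [CharTwo.add_self_eq_zero, add_zero]
      · rw [add_left_comm, CharTwo.add_self_eq_zero, add_zero]
    obtain ⟨s, hs, t, ht, rfl⟩ := hdec u
    obtain ⟨s', hs', t', ht', rfl⟩ := hdec v
    apply huv
    have hs1 : Commute c s := hcS s hs
    have hs1' : Commute c s' := hcS s' hs'
    have ht1 : Commute c t := hcS t ht
    have ht1' : Commute c t' := hcS t' ht'
    have hss : Commute s s' := hcomm hs hs'
    have hst : Commute s t' := hcomm hs ht'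
    have hts : Commute t s' := hcomm ht hs'
    have htt : Commute t t' := hcomm ht ht'
    exact ((((Commute.refl c).mul_right hs1').mul_left (hs1.symm.mul_right hss)).add_right
      (ht1'.mul_left hst)).add_left ((ht1.symm.mul_right hts).add_right htt)
  omega

/-- The map `Q / Alt(Q, θ) → Q` induced by `a ↦ a - θ a`. -/
def altQuot (θ : FInvolution F Q) : (Q ⧸ Alt θ) →ₗ[F] Q :=
  (Alt θ).liftQ (LinearMap.id - θ.toLinearMap) (alt_le_ker θ)

/-- This kernel is Sym/Alt, the target of the semilinear maps used in both bounds. -/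
theorem finrank_ker_altQuot [Algebra.IsCentral F Q] (hQ : Module.finrank F Q = 4)
    (θ : FInvolution F Q) : Module.finrank F (LinearMap.ker (altQuot θ)) = 2 := by
  have hfin : Module.Finite F Q := Module.finite_of_finrank_pos (by omega)
  have h1 := LinearMap.finrank_range_add_finrank_ker (altQuot θ)
  have h2 := (Alt θ).finrank_quotient_add_finrank
  have h3 : LinearMap.range (altQuot θ) = Alt θ := Submodule.range_liftQ _ _ _
  rw [h3] at h1
  rw [finrank_alt hQ θ] at h1 h2
  omega

theorem mkQ_mem_ker_altQuot (θ : FInvolution F Q) (x : Q) :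
    (Alt θ).mkQ x ∈ LinearMap.ker (altQuot θ) ↔ θ x = x := by
  rw [← mem_ker_iff]
  rfl

section Forms

variable {θ : FInvolution F Q} {V : Type*} [AddCommGroup V] [Module Qᵐᵒᵖ V]

variable [Module F V] [IsScalarTower F Qᵐᵒᵖ V]

/-- The polar form `h(x, y) + h(y, x)` of `x ↦ h(x, x)`, with values in `Alt(Q, θ)`. -/
def HermForm.polar (φ : HermForm θ V) (x : V) : V →ₗ[F] Alt θ where
  toFun y := ⟨φ.form x y + θ (φ.form x y), (mem_alt_iff θ _).2 ⟨_, rfl⟩⟩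
  map_add' y z := Subtype.ext (by simp only [map_add, Submodule.coe_add]; abel)
  map_smul' c y := Subtype.ext (by
    simp only [φ.form_smul_right_field, map_smul, RingHom.id_apply, Submodule.coe_smul, smul_add])

variable [Module.Finite F V] [Algebra.IsCentral F Q]
  [Module.Finite (frobenius F 2).fieldRange F]

/-- Because Alt is a line, x ↦ h(x,x) is on K an ordinary F-quadratic form with polar form
`HermForm.polar`. -/
theorem HermForm.finrank_le_of_anisotropic_alt (hQ : Module.finrank F Q = 4) (φ : HermForm θ V)
    (K : Submodule F V) (hK : ∀ x ∈ K, φ.form x x ∈ Alt θ)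
    (han : ∀ x ∈ K, φ.form x x = 0 → x = 0) :
    Module.finrank F K ≤ 2 * Module.finrank (frobenius F 2).fieldRange F := by
  have hfin : Module.Finite F Q := Module.finite_of_finrank_pos (by omega)
  refine finrank_le_of_anisotropic (finrank_alt hQ θ)
    (fun x : K => (⟨φ.form x x, hK x x.2⟩ : Alt θ)) (fun x => (φ.polar x).comp K.subtype)
    (fun x y => Subtype.ext (φ.form_add_self x y))
    (fun c x => Subtype.ext (φ.form_smul_self (x : V) c))
    (fun x hx => Subtype.ext (han x x.2 (congrArg Subtype.val hx)))

theorem HermForm.finrank_le (hQ : Module.finrank F Q = 4) (φ : HermForm θ V)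
    (hφ : φ.IsAnisotropic) :
    Module.finrank Qᵐᵒᵖ V ≤ Module.finrank (frobenius F 2).fieldRange F := by
  have hfin : Module.Finite F Q := Module.finite_of_finrank_pos (by omega)
  obtain ⟨K, hK, hle⟩ := exists_finrank_le_add_of_semilinear (F := F)
    (fun x : V => (⟨(Alt θ).mkQ (φ.form x x),
      (mkQ_mem_ker_altQuot θ _).2 (φ.apply_form_self x)⟩ : LinearMap.ker (altQuot θ)))
    (fun x y => Subtype.ext (by
      have h : (Alt θ).mkQ (φ.form x y + θ (φ.form x y)) = 0 :=
        (Submodule.Quotient.mk_eq_zero _).2 ((mem_alt_iff θ _).2 ⟨_, rfl⟩)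
      rw [Submodule.coe_add]
      dsimp only
      rw [φ.form_add_self, map_add, h, add_zero, map_add]))
    (fun c x => Subtype.ext (by
      rw [Submodule.coe_smul]
      dsimp only
      rw [φ.form_smul_self, map_smul]))
  have hK2 := φ.finrank_le_of_anisotropic_alt hQ K
    (fun x hx => (Submodule.Quotient.mk_eq_zero _).1 (congrArg Subtype.val (hK x hx)))
    (fun x _ h => by_contra fun hx => hφ x hx h)
  have h4 := finrank_eq_four_mul (F := F) hQ (⊤ : Submodule Qᵐᵒᵖ V)
  rw [Submodule.restrictScalars_top, finrank_top, finrank_top] at h4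
  rw [finrank_ker_altQuot hQ] at hle
  omega

theorem QuadForm.finrank_le (hQ : Module.finrank F Q = 4) (ρ : QuadForm θ V)
    (hρ : ρ.IsAnisotropic) :
    2 * Module.finrank Qᵐᵒᵖ V ≤ 3 * Module.finrank (frobenius F 2).fieldRange F := by
  have hfin : Module.Finite F Q := Module.finite_of_finrank_pos (by omega)
  have : Module.Finite Qᵐᵒᵖ V := Module.Finite.of_restrictScalars_finite F Qᵐᵒᵖ V
  obtain ⟨φ, hφ⟩ := ρ.exists_polar
  have hsmul : ∀ (c : F) x, ρ.form (c • x) = c ^ 2 • ρ.form x := fun c x => by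
    rw [smul_eq_op_smul (Q := Q), ρ.map_smul, conjQuot_algebraMap]
  -- In characteristic 2, comparing q(x + x) = 0 with 2q(x) = 0 leaves h(x,x) ≡ 0 mod Alt.
  have hself : ∀ x, φ.form x x ∈ Alt θ := fun x => by
    have h := hφ x x
    rw [← two_smul F x, hsmul, CharTwo.two_eq_zero, zero_pow two_ne_zero, zero_smul, zero_sub,
      sub_eq_add_neg, ← neg_add, ← two_smul F (ρ.form x), CharTwo.two_eq_zero, zero_smul,
      neg_zero] at h
    exact (Submodule.Quotient.mk_eq_zero _).1 h.symm
  have hrank : Module.finrank Qᵐᵒᵖ Q = 1 :=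
    finrank_eq_one 1 one_ne_zero fun y => ⟨MulOpposite.op y, one_mul y⟩
  have : Module.Finite Qᵐᵒᵖ Q := Module.finite_of_finrank_pos (by omega)
  obtain ⟨W, C, hW, hC, hle⟩ := exists_isotropic_anisotropic hrank φ.toLinearMapRight
    fun x y h => φ.form_eq_zero_symm h
  have hC2 := φ.finrank_le_of_anisotropic_alt hQ (C.restrictScalars F) (fun x _ => hself x) hC
  rw [finrank_eq_four_mul hQ] at hC2
  have hsym : ∀ x ∈ W, ρ.form x ∈ LinearMap.ker (altQuot θ) := by
    intro x hx
    obtain ⟨a, ha⟩ := (Alt θ).mkQ_surjective (ρ.form x)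
    rw [← ha, mkQ_mem_ker_altQuot]
    by_contra hne
    -- Expand q(x + xd) with h(x,xd) = 0: the cross terms ad + θ(d)a lie in Alt, and ad ≡ θ(d)θ(a)
    -- mod Alt. If a + θ(a) ≠ 0, letting d vary would fill all of Q, contradicting dim Alt = 1.
    have hmem : ∀ d : Q, θ d * (a + θ a) ∈ Alt θ := by
      intro d
      have h := hφ x (MulOpposite.op d • x)
      have hx1 : x + MulOpposite.op d • x = MulOpposite.op (1 + d) • x := by
        rw [MulOpposite.op_add, add_smul, MulOpposite.op_one, one_smul]
      rw [hx1, ρ.map_smul, ρ.map_smul, ← ha, φ.form_smul_right,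
        show φ.form x x = 0 from hW x hx x hx, zero_mul, map_zero] at h
      change (Alt θ).mkQ (θ (1 + d) * (a * (1 + d))) - (Alt θ).mkQ a -
        (Alt θ).mkQ (θ d * (a * d)) = 0 at h
      rw [← map_sub, ← map_sub, map_add, θ.apply_one] at h
      have h1 := (Submodule.Quotient.mk_eq_zero _).1 h
      have h2 : a * d - θ (a * d) ∈ Alt θ := ⟨a * d, rfl⟩
      rw [θ.apply_mul] at h2
      have h3 := (Alt θ).sub_mem h1 h2
      convert h3 using 1
      noncomm_ring
    have htop : Alt θ = ⊤ := by
      refine eq_top_iff.2 fun y _ => ?_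
      have hc : a + θ a ≠ 0 := fun h => hne (by
        rwa [← sub_eq_add_of_algebra (F := F), sub_eq_zero, eq_comm] at h)
      have := hmem (θ (y * (a + θ a)⁻¹))
      rwa [θ.apply_apply, inv_mul_cancel_right₀ hc] at this
    have h1 := finrank_alt hQ θ
    rw [htop, finrank_top] at h1
    omega
  have hWd := finrank_le_of_semilinear_injective
    (fun x : W.restrictScalars F => (⟨ρ.form x, hsym x x.2⟩ : LinearMap.ker (altQuot θ)))
    (fun x y => Subtype.ext (by
      have h := hφ x y
      rw [show φ.form x y = 0 from hW x x.2 y y.2, map_zero, sub_sub, sub_eq_zero] at h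
      exact h))
    (fun c x => Subtype.ext (hsmul c x))
    (fun x hx => Subtype.ext (by_contra fun h => hρ x h (congrArg Subtype.val hx)))
  rw [finrank_eq_four_mul hQ, finrank_ker_altQuot hQ] at hWd
  omega

end Forms

end Quaternion

theorem finite_of_degSq_ne_top {F : Type*} [Field F] [CharP F 2] (h : degSq F ≠ ⊤) :
    Module.Finite (frobenius F 2).fieldRange F ∧
      degSq F = Module.finrank (frobenius F 2).fieldRange F := by
  have hfin : Module.Finite (frobenius F 2).fieldRange F := by
    rw [← Module.rank_lt_aleph0_iff]
    by_contra! h'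
    exact h (Cardinal.toENat_eq_top.2 h')
  exact ⟨hfin, by rw [degSq, ← Module.finrank_eq_rank, Cardinal.toENat_nat]⟩

end GenForm

theorem mainTheorem5 {F : Type*} [Field F] [CharP F 2]
    {Q : Type*} [DivisionRing Q] [Algebra F Q] [Algebra.IsCentral F Q]
    (hQ : Module.finrank F Q = 4) (θ : GenForm.FInvolution F Q) :
    GenForm.uPlus θ ≤ GenForm.degSq F ∧
    (GenForm.uInv θ : ℝ≥0∞) ≤ (3 / 2 : ℝ≥0∞) * (GenForm.degSq F : ℝ≥0∞) := by
  by_cases htop : GenForm.degSq F = ⊤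
  · rw [htop]
    exact ⟨le_top, by rw [ENat.toENNReal_top, ENNReal.mul_top (by simp)]; exact le_top⟩
  obtain ⟨hF, hd⟩ := GenForm.finite_of_degSq_ne_top htop
  have hfin : Module.Finite F Q := Module.finite_of_finrank_pos (by omega)
  have hfin' : Module.Finite F Qᵐᵒᵖ := Module.Finite.equiv (MulOpposite.opLinearEquiv F)
  rw [hd]
  set d := Module.finrank (frobenius F 2).fieldRange F
  constructor
  · refine sSup_le ?_
    rintro _ ⟨V, _, _, _, φ, hφ, rfl⟩
    -- V carries only a Q-structure; its F-structure is obtained by restricting scalars.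
    let _ : Module F V := Module.compHom V (algebraMap F Qᵐᵒᵖ)
    have : IsScalarTower F Qᵐᵒᵖ V := IsScalarTower.of_algebraMap_smul fun _ _ => rfl
    have : Module.Finite F V := Module.Finite.trans Qᵐᵒᵖ V
    exact_mod_cast φ.finrank_le hQ hφ
  · have h : GenForm.uInv θ ≤ ((3 * d / 2 : ℕ) : ℕ∞) := by
      refine sSup_le ?_
      rintro _ ⟨V, _, _, _, ρ, hρ, rfl⟩
      let _ : Module F V := Module.compHom V (algebraMap F Qᵐᵒᵖ)
      have : IsScalarTower F Qᵐᵒᵖ V := IsScalarTower.of_algebraMap_smul fun _ _ => rfl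
      have : Module.Finite F V := Module.Finite.trans Qᵐᵒᵖ V
      have := ρ.finrank_le hQ hρ
      exact_mod_cast (show _ ≤ 3 * d / 2 by omega)
    refine (ENat.toENNReal_le.2 h).trans ?_
    rw [ENat.toENNReal_coe, ENat.toENNReal_coe, ← ENNReal.mul_div_right_comm,
      ENNReal.le_div_iff_mul_le (by simp) (by simp)]
    exact_mod_cast Nat.div_mul_le_self (3 * d) 2
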